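/- Let $k$ be a field and let $A$ be an associative, not necessarily unital, algebra over $k$ (of arbitrary dimension). A subalgebra of $A$ is a $k$-subspace closed under multiplication (it need not contain an identity element). An unrefinable chain of length $t \geq 0$ of $A$ is a chain of subalgebras $A = A_0 > A_1 > \cdots > A_t = 0$ in which each $A_i$ $(1 \leq i \leq t)$ is a maximal (proper) subalgebra of $A_{i-1}$. The length $l(A)$ is the maximal length of an unrefinable chain of $A$, with $l(A) = \infty$ if there is no unrefinable chain or no unrefinable chain of maximal length. The depth $\lambda(A)$ is the minimal length of an unrefinable chain of $A$, with $\lambda(A) = \infty$ if there is no unrefinable chain. Then the following are equivalent: (i) $\lambda(A) < \infty$; (ii) $l(A) < \infty$; (iii) $\dim_k A < \infty$. -/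

import Mathlib

namespace AlgChain

universe u v

section

variable (k : Type u) (A : Type v) [Field k] [NonUnitalRing A] [Module k A]
  [IsScalarTower k A A] [SMulCommClass k A A]

/-- `c` is an unrefinable chain `A = c 0 > c 1 > ⋯ > c t = 0` of length `t`: every `c (i + 1)` is a
maximal proper subalgebra of `c i`. Subalgebras are `k`-subspaces closed under multiplication, not
required to contain an identity. `B ⋖ C` says that `B < C` and that no subalgebra lies strictly
between `B` and `C`, that is, `B` is a maximal subalgebra of `C`. -/
def IsUnrefinableChain (t : ℕ) (c : Fin (t + 1) → NonUnitalSubalgebra k A) : Prop :=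
  c 0 = ⊤ ∧ c (Fin.last t) = ⊥ ∧ ∀ i : Fin t, c i.succ ⋖ c i.castSucc

/-- The set of the lengths of all unrefinable chains of `A`. -/
def chainLengths : Set ℕ :=
  {t | ∃ c : Fin (t + 1) → NonUnitalSubalgebra k A, IsUnrefinableChain k A t c}

open Classical in
/-- The length `l(A)`: the maximal length of an unrefinable chain, and `∞` if there is no
unrefinable chain, or none of maximal length. -/
noncomputable def length : ℕ∞ :=
  if ∃ t, IsGreatest (chainLengths k A) t then ((sSup (chainLengths k A) : ℕ) : ℕ∞) else ⊤

open Classical in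
/-- The depth `λ(A)`: the minimal length of an unrefinable chain, and `∞` if there is no
unrefinable chain. -/
noncomputable def depth : ℕ∞ :=
  if (chainLengths k A).Nonempty then ((sInf (chainLengths k A) : ℕ) : ℕ∞) else ⊤

end

end AlgChain

/-! Everything rests on one fact: an algebra `A` with a finite-dimensional maximal subalgebra `M` is
finite-dimensional (`finite_of_isCoatom`). Climbing a chain from 0 then gives (i) ⇒ (iii); dimension
counting gives (iii) ⇒ (ii). Adjoin a unit and, by induction on `dim M`, factor out ideals of `A`
inside `M`, so that `M` contains none but 0. Suppose `A` is infinite-dimensional. It is finitely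
generated, so it has no locally finite ideal of finite codimension (`LocFinite.finite`). Such ideals
arise from elements with `aAa` finite-dimensional (`locFinite_of_corner_fg`). This excludes
square-zero ideals of `M`, so `M` is semisimple; it also excludes integral elements with
finite-dimensional centralizer, so the center of `M` is central in `A` and `M` is simple. Then `A`
is generated by `M` and its centralizer (`exists_sum_mul_of_isCentral`). If the centralizer lies in
`M`, then `A = M`; if not, `A = M[c]` with `c` algebraic over `M` (`finite_of_commute`). Both are
absurd. -/

namespace AlgChain

/-! ### Locally finite ideals. -/

section LocallyFinite

variable {k : Type*} {A : Type*} [Field k] [Ring A] [Algebra k A]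

/-- A subspace all of whose finite-dimensional subspaces lie in finite-dimensional
multiplicatively closed subspaces. -/
def LocFinite (I : Submodule k A) : Prop :=
  ∀ T ≤ I, T.FG → ∃ V : Submodule k A, V.FG ∧ T ≤ V ∧ V * V ≤ V

/-- The subspace `I` is a two-sided ideal. -/
def IsBiIdeal (I : Submodule k A) : Prop :=
  ∀ x ∈ I, ∀ a : A, a * x ∈ I ∧ x * a ∈ I

lemma IsBiIdeal.mul_mul_le {I : Submodule k A} (hI : IsBiIdeal I) {T : Submodule k A} (hT : T ≤ I)
    (U V : Submodule k A) : U * T * V ≤ I := by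
  refine Submodule.mul_le.2 fun x hx v _ => (hI x ?_ v).2
  exact (Submodule.mul_le.2 fun u _ t ht => (hI t (hT ht) u).1 : U * T ≤ I) hx

lemma isBiIdeal_top_mul_mul_top (T : Submodule k A) : IsBiIdeal (⊤ * T * ⊤) := by
  intro x hx a
  constructor
  · have : a * x ∈ ⊤ * (⊤ * T * ⊤) := Submodule.mul_mem_mul Submodule.mem_top hx
    rw [← mul_assoc, ← mul_assoc] at this
    exact (mul_le_mul_left (mul_le_mul_left le_top _) _ : ⊤ * ⊤ * T * ⊤ ≤ ⊤ * T * ⊤) this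
  · have : x * a ∈ ⊤ * T * ⊤ * ⊤ := Submodule.mul_mem_mul hx Submodule.mem_top
    rw [mul_assoc _ ⊤ ⊤] at this
    exact (mul_le_mul_right le_top _ : ⊤ * T * (⊤ * ⊤) ≤ ⊤ * T * ⊤) this

lemma IsBiIdeal.sup {I J : Submodule k A} (hI : IsBiIdeal I) (hJ : IsBiIdeal J) :
    IsBiIdeal (I ⊔ J) := by
  intro x hx a
  obtain ⟨i, hi, j, hj, rfl⟩ := Submodule.mem_sup.1 hx
  rw [mul_add, add_mul]
  exact ⟨Submodule.add_mem_sup (hI i hi a).1 (hJ j hj a).1,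
    Submodule.add_mem_sup (hI i hi a).2 (hJ j hj a).2⟩

lemma le_top_mul_mul_top (T : Submodule k A) : T ≤ ⊤ * T * ⊤ := by
  intro x hx
  simpa using Submodule.mul_mem_mul (Submodule.mul_mem_mul (Submodule.mem_top (x := (1 : A))) hx)
    (Submodule.mem_top (x := (1 : A)))

/-- The key extension property: a subspace that is multiplicatively closed up to a locally finite
ideal lies in a finite-dimensional multiplicatively closed subspace. -/
lemma LocFinite.exists_closed {I : Submodule k A} (hI : IsBiIdeal I) (hL : LocFinite I)
    {W T : Submodule k A} (hW : W.FG) (hT : T.FG) (hTI : T ≤ I) (hWW : W * W ≤ W ⊔ T) :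
    ∃ V : Submodule k A, V.FG ∧ W ⊔ T ≤ V ∧ V * V ≤ V := by
  set U : Submodule k A := 1 ⊔ W with hU
  have h1U : (1 : Submodule k A) ≤ U := le_sup_left
  have hUfg : U.FG := Submodule.FG.sup (by
    rw [Submodule.one_eq_span]; exact Submodule.fg_span_singleton _) hW
  have hUU : U * U ≤ U ⊔ T := by
    simp only [hU, Submodule.sup_mul, Submodule.mul_sup, one_mul, mul_one]
    refine sup_le (sup_le ?_ ?_) (sup_le ?_ (hWW.trans ?_))
    · exact le_sup_left.trans le_sup_left
    · exact le_sup_right.trans le_sup_left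
    · exact le_sup_right.trans le_sup_left
    · exact sup_le_sup_right le_sup_right _
  have hT' : (U * T * U).FG := (hUfg.mul hT).mul hUfg
  obtain ⟨B₀, hB₀, hTB₀, hBB₀⟩ := hL _ (hI.mul_mul_le hTI U U) hT'
  -- `B₀` only bounds the dimension: it need not be stable under `U`. The subalgebra generated by
  -- `UTU` is, because `UU ≤ U + T`.
  let S := NonUnitalAlgebra.adjoin k ((U * T * U : Submodule k A) : Set A)
  let B : Submodule k A := S.toSubmodule
  have hTB : U * T * U ≤ B := NonUnitalAlgebra.subset_adjoin k
  have hBB : B * B ≤ B := Submodule.mul_le.2 fun x hx y hy => S.mul_mem hx hy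
  have hB : B.FG := by
    refine hB₀.of_le fun x hx => ?_
    refine NonUnitalAlgebra.adjoin_induction (p := fun x _ => x ∈ B₀) (fun y hy => hTB₀ hy)
      (fun _ _ _ _ h h' => B₀.add_mem h h') B₀.zero_mem
      (fun _ _ _ _ h h' => hBB₀ (Submodule.mul_mem_mul h h'))
      (fun r _ _ h => B₀.smul_mem r h) hx
  have hTU : T * U ≤ U * T * U := by
    simpa [mul_assoc] using mul_le_mul_left h1U (T * U)
  have hUT : U * T ≤ U * T * U := by
    simpa using mul_le_mul_right h1U (U * T)
  have hTT : T ≤ U * T * U := le_trans (by simpa using mul_le_mul_left h1U T) hUT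
  have hUT' : U * (U * T * U) ≤ B := by
    rw [← mul_assoc, ← mul_assoc, mul_assoc (U * U)]
    refine (mul_le_mul_left hUU _).trans ?_
    rw [Submodule.sup_mul, ← mul_assoc]
    exact sup_le hTB ((mul_le_mul' (hTT.trans hTB) (hTU.trans hTB)).trans hBB)
  have hT'U : (U * T * U) * U ≤ B := by
    rw [mul_assoc]
    refine (mul_le_mul_right hUU _).trans ?_
    rw [Submodule.mul_sup]
    exact sup_le hTB ((mul_le_mul' (hUT.trans hTB) (hTT.trans hTB)).trans hBB)
  have hUB : U * B ≤ B := by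
    refine Submodule.mul_le.2 fun u hu b hb => ?_
    refine NonUnitalAlgebra.adjoin_induction (p := fun b _ => u * b ∈ B)
      (fun y hy => hUT' (Submodule.mul_mem_mul hu hy))
      (fun _ _ _ _ h h' => by rw [mul_add]; exact B.add_mem h h') (by simp)
      (fun x y _ hy h _ => ?_) (fun r _ _ h => by rw [mul_smul_comm]; exact B.smul_mem r h) hb
    rw [← mul_assoc]
    exact hBB (Submodule.mul_mem_mul h hy)
  have hBU : B * U ≤ B := by
    refine Submodule.mul_le.2 fun b hb u hu => ?_
    refine NonUnitalAlgebra.adjoin_induction (p := fun b _ => b * u ∈ B)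
      (fun y hy => hT'U (Submodule.mul_mem_mul hy hu))
      (fun _ _ _ _ h h' => by rw [add_mul]; exact B.add_mem h h') (by simp)
      (fun x y hx _ _ h => ?_) (fun r _ _ h => by rw [smul_mul_assoc]; exact B.smul_mem r h) hb
    rw [mul_assoc]
    exact hBB (Submodule.mul_mem_mul hx h)
  refine ⟨U ⊔ B, hUfg.sup hB, sup_le_sup le_sup_right (hTT.trans hTB), ?_⟩
  simp only [Submodule.sup_mul, Submodule.mul_sup]
  exact sup_le (sup_le (hUU.trans (sup_le_sup_left (hTT.trans hTB) _)) (hBU.trans le_sup_right))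
    (sup_le (hUB.trans le_sup_right) (hBB.trans le_sup_right))

lemma exists_fg_le_sup {I J U : Submodule k A} (hU : U.FG) (h : U ≤ I ⊔ J) :
    ∃ T T' : Submodule k A, T.FG ∧ T'.FG ∧ T ≤ I ∧ T' ≤ J ∧ U ≤ T ⊔ T' := by
  classical
  obtain ⟨s, rfl⟩ := hU
  have h' : ∀ u : s, ∃ i ∈ I, ∃ j ∈ J, i + j = u.1 := fun u =>
    Submodule.mem_sup.1 (h (Submodule.subset_span u.2))
  choose i hi j hj hij using h'
  refine ⟨Submodule.span k (Set.range i), Submodule.span k (Set.range j),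
    Submodule.fg_span (Set.finite_range _), Submodule.fg_span (Set.finite_range _),
    Submodule.span_le.2 (Set.range_subset_iff.2 hi),
    Submodule.span_le.2 (Set.range_subset_iff.2 hj), Submodule.span_le.2 fun u hu => ?_⟩
  rw [SetLike.mem_coe, show u = i ⟨u, hu⟩ + j ⟨u, hu⟩ from (hij ⟨u, hu⟩).symm]
  exact Submodule.add_mem_sup (Submodule.subset_span ⟨_, rfl⟩) (Submodule.subset_span ⟨_, rfl⟩)

/-- A closed `W` covering the `J`-part satisfies the hypothesis of `LocFinite.exists_closed` for any
`T ≤ I`, so the `I`-part can be added to it. -/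
lemma LocFinite.sup {I J : Submodule k A} (hI : IsBiIdeal I) (hLI : LocFinite I)
    (hLJ : LocFinite J) : LocFinite (I ⊔ J) := by
  intro U hU hUfg
  obtain ⟨T, T', hT, hT', hTI, hTJ, hle⟩ := exists_fg_le_sup hUfg hU
  obtain ⟨W, hW, hTW, hWW⟩ := hLJ T' hTJ hT'
  obtain ⟨V, hV, hWV, hVV⟩ := hLI.exists_closed hI hW hT hTI (hWW.trans le_sup_left)
  exact ⟨V, hV, hle.trans (sup_le (le_sup_right.trans hWV) ((hTW.trans le_sup_left).trans hWV)),
    hVV⟩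

/-- The subspace `a A a`. -/
def corner (k : Type*) {A : Type*} [Field k] [Ring A] [Algebra k A] (a : A) : Submodule k A :=
  LinearMap.range (LinearMap.mulLeft k a ∘ₗ LinearMap.mulRight k a)

lemma mem_corner {a x : A} : x ∈ corner k a ↔ ∃ y, a * (y * a) = x := by
  simp [corner]

/-- If `a A a` is finite-dimensional, then the ideal generated by `a` is locally finite. -/
lemma locFinite_of_corner_fg {a : A} (ha : (corner k a).FG) :
    LocFinite (⊤ * Submodule.span k {a} * ⊤) := by
  intro T hT hTfg
  have key : ∃ X : Submodule k A, X.FG ∧ T ≤ X * Submodule.span k {a} * X := by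
    have mono : ∀ X Y : Submodule k A, X ≤ Y →
        X * Submodule.span k {a} * X ≤ Y * Submodule.span k {a} * Y :=
      fun X Y h => mul_le_mul' (mul_le_mul_left h _) h
    have elt : ∀ t ∈ (⊤ : Submodule k A) * Submodule.span k {a} * ⊤,
        ∃ X : Submodule k A, X.FG ∧ t ∈ X * Submodule.span k {a} * X := by
      intro t ht
      induction ht using Submodule.mul_induction_on' with
      | mem_mul_mem m hm n hn =>
        induction hm using Submodule.mul_induction_on' with
        | mem_mul_mem x hx y hy =>
          refine ⟨Submodule.span k {x} ⊔ Submodule.span k {n},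
            (Submodule.fg_span_singleton _).sup (Submodule.fg_span_singleton _), ?_⟩
          exact Submodule.mul_mem_mul (Submodule.mul_mem_mul
            (Submodule.mem_sup_left (Submodule.mem_span_singleton_self _)) hy)
            (Submodule.mem_sup_right (Submodule.mem_span_singleton_self _))
        | add x hx y hy ihx ihy =>
          obtain ⟨X, hX, hx'⟩ := ihx
          obtain ⟨Y, hY, hy'⟩ := ihy
          refine ⟨X ⊔ Y, hX.sup hY, ?_⟩
          rw [add_mul]
          exact Submodule.add_mem _ (mono _ _ le_sup_left hx') (mono _ _ le_sup_right hy')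
      | add x hx y hy ihx ihy =>
        obtain ⟨X, hX, hx'⟩ := ihx
        obtain ⟨Y, hY, hy'⟩ := ihy
        exact ⟨X ⊔ Y, hX.sup hY,
          Submodule.add_mem _ (mono _ _ le_sup_left hx') (mono _ _ le_sup_right hy')⟩
    obtain ⟨s, rfl⟩ := hTfg
    choose X hX hs using fun t : s => elt t.1 (hT (Submodule.subset_span t.2))
    refine ⟨⨆ t, X t, Submodule.fg_iSup _ hX, Submodule.span_le.2 fun t ht => ?_⟩
    exact mono _ _ (le_iSup X ⟨t, ht⟩) (hs ⟨t, ht⟩)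
  obtain ⟨X, hX, hTX⟩ := key
  -- Elements of `P = ka + aAa` begin and end with `a`, so `P(XX)P ≤ aAa ≤ P`, and therefore `XPX`
  -- is closed.
  set P : Submodule k A := Submodule.span k {a} ⊔ corner k a with hP
  have hPfg : P.FG := (Submodule.fg_span_singleton _).sup ha
  have hPl : ∀ p ∈ P, ∃ y, p = a * y := by
    intro p hp
    obtain ⟨x, hx, z, hz, rfl⟩ := Submodule.mem_sup.1 hp
    obtain ⟨c, rfl⟩ := Submodule.mem_span_singleton.1 hx
    obtain ⟨y, rfl⟩ := mem_corner.1 hz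
    exact ⟨algebraMap k A c + y * a, by rw [mul_add, ← Algebra.commutes, Algebra.smul_def]⟩
  have hPr : ∀ p ∈ P, ∃ y, p = y * a := by
    intro p hp
    obtain ⟨x, hx, z, hz, rfl⟩ := Submodule.mem_sup.1 hp
    obtain ⟨c, rfl⟩ := Submodule.mem_span_singleton.1 hx
    obtain ⟨y, rfl⟩ := mem_corner.1 hz
    exact ⟨algebraMap k A c + a * y, by rw [add_mul, Algebra.smul_def, mul_assoc]⟩
  have hPP : P * (X * X) * P ≤ P := by
    refine Submodule.mul_le.2 fun m hm n hn => ?_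
    refine Submodule.mul_induction_on hm (fun p hp x _ => ?_) fun x y hx hy => ?_
    · obtain ⟨y, rfl⟩ := hPl p hp
      obtain ⟨z, rfl⟩ := hPr n hn
      exact Submodule.mem_sup_right (mem_corner.2 ⟨y * x * z, by simp only [mul_assoc]⟩)
    · rw [add_mul]; exact P.add_mem hx hy
  refine ⟨X * P * X, (hX.mul hPfg).mul hX,
    hTX.trans (mul_le_mul_left (mul_le_mul_right le_sup_left _) _), ?_⟩
  calc X * P * X * (X * P * X) = X * (P * (X * X) * P) * X := by simp only [mul_assoc]
    _ ≤ X * P * X := mul_le_mul_left (mul_le_mul_right hPP _) _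

/-- A finitely generated algebra with a locally finite ideal of finite codimension is
finite-dimensional. -/
lemma LocFinite.finite [Algebra.FiniteType k A] {I : Submodule k A} (hI : IsBiIdeal I)
    (hL : LocFinite I) {W : Submodule k A} (hW : W.FG) (hWI : W ⊔ I = ⊤) : Module.Finite k A := by
  obtain ⟨s, hs⟩ := (Algebra.FiniteType.out : (⊤ : Subalgebra k A).FG)
  -- With 1 and the generators in `W'`, the closed space `V` around it must be all of `A`.
  set W' : Submodule k A := W ⊔ 1 ⊔ Submodule.span k (s : Set A) with hW'
  have hW'fg : W'.FG := (hW.sup (by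
    rw [Submodule.one_eq_span]; exact Submodule.fg_span_singleton _)).sup
    (Submodule.fg_span s.finite_toSet)
  have hW'I : W' ⊔ I = ⊤ := top_le_iff.1 (hWI.ge.trans
    (sup_le_sup_right (le_sup_left.trans le_sup_left) _))
  obtain ⟨T, T', hT, hT', hTW, hTI, hle⟩ :=
    exists_fg_le_sup (hW'fg.mul hW'fg) (le_top.trans hW'I.ge)
  obtain ⟨V, hV, hWV, hVV⟩ := hL.exists_closed hI hW'fg hT' hTI
    (hle.trans (sup_le_sup_right hTW _))
  have h1 : (1 : A) ∈ V := hWV (Submodule.mem_sup_left (Submodule.mem_sup_left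
    (Submodule.mem_sup_right (Submodule.one_le.1 le_rfl))))
  let S := V.toSubalgebra h1 fun x y hx hy => hVV (Submodule.mul_mem_mul hx hy)
  have hS : S = ⊤ := by
    rw [← top_le_iff, ← hs]
    exact Algebra.adjoin_le fun x hx =>
      hWV (Submodule.mem_sup_left (Submodule.mem_sup_right (Submodule.subset_span hx)))
  have hVtop : V = ⊤ := by
    rw [eq_top_iff]
    intro x _
    have : x ∈ S := hS ▸ Algebra.mem_top
    exact this
  exact ⟨hVtop ▸ hV⟩

end LocallyFinite

/-! ### Integral elements with finite-dimensional centralizer. -/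

section Centralizer

open scoped TensorProduct

variable {k : Type*} {A : Type*} [Field k] [Ring A] [Algebra k A]

lemma locFinite_bot : LocFinite (⊥ : Submodule k A) := fun T hT _ =>
  ⟨⊥, Submodule.fg_bot, hT, by simp⟩

/-- Each `a i` generates a locally finite ideal; the sum of these contains 1, so it is `A`. -/
lemma finite_of_sum_mul_eq_one [Algebra.FiniteType k A] {ι : Type*} (s : Finset ι) (a g : ι → A)
    (ha : ∀ i ∈ s, (corner k (a i)).FG) (h1 : ∑ i ∈ s, g i * a i = 1) : Module.Finite k A := by
  classical
  have key : ∀ t ⊆ s, ∃ I : Submodule k A, IsBiIdeal I ∧ LocFinite I ∧ ∀ i ∈ t, a i ∈ I := by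
    intro t
    induction t using Finset.induction_on with
    | empty =>
      exact fun _ => ⟨⊥, fun x hx a => by simp_all, locFinite_bot, by simp⟩
    | insert i t hi ih =>
      intro hts
      obtain ⟨I, hI, hL, hm⟩ := ih fun j hj => hts (Finset.mem_insert_of_mem hj)
      refine ⟨I ⊔ ⊤ * Submodule.span k {a i} * ⊤, hI.sup (isBiIdeal_top_mul_mul_top _),
        hL.sup hI (locFinite_of_corner_fg (ha i (hts (Finset.mem_insert_self _ _)))), ?_⟩
      intro j hj
      rcases Finset.mem_insert.1 hj with rfl | hj
      · exact Submodule.mem_sup_right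
          (le_top_mul_mul_top _ (Submodule.mem_span_singleton_self _))
      · exact Submodule.mem_sup_left (hm j hj)
  obtain ⟨I, hI, hL, hm⟩ := key s subset_rfl
  refine hL.finite hI (W := ⊥) Submodule.fg_bot ?_
  have : (1 : A) ∈ I := h1 ▸ I.sum_mem fun i hi => (hI _ (hm i hi) _).1
  rw [bot_sup_eq, eq_top_iff]
  exact fun x _ => by simpa using (hI _ this x).1

/-- The inner derivation `x ↦ f x - x f`. -/
def innerDer (k : Type*) {A : Type*} [Field k] [Ring A] [Algebra k A] (f : A) : A →ₗ[k] A :=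
  LinearMap.mulLeft k f - LinearMap.mulRight k f

@[simp] lemma innerDer_apply (f x : A) : innerDer k f x = f * x - x * f := rfl

/-- Put `g = f - c`. The map `x ↦ gx - xg` is `innerDer k f`, with finite-dimensional kernel, and it
sends `V` into `gV + Vg`, whose summands need one power of `g` fewer on one side. Hence induction on
`a + b`. -/
lemma fg_of_pow_mul_eq_zero {f : A} (hf : (LinearMap.ker (innerDer k f)).FG) (c : k) (n : ℕ) :
    ∀ a b : ℕ, a + b = n → ∀ V : Submodule k A,
      (∀ x ∈ V, (f - algebraMap k A c) ^ a * x = 0 ∧ x * (f - algebraMap k A c) ^ b = 0) →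
      V.FG := by
  set g := f - algebraMap k A c with hg
  have hD : ∀ x, innerDer k f x = g * x - x * g := by
    intro x
    rw [innerDer_apply, hg, sub_mul, mul_sub, Algebra.commutes]
    abel
  induction n with
  | zero =>
    intro a b hab V hV
    have : V = ⊥ := by
      rw [eq_bot_iff]
      intro x hx
      obtain rfl : a = 0 := by omega
      simpa using (hV x hx).1
    exact this ▸ Submodule.fg_bot
  | succ n ih =>
    intro a b hab V hV
    rcases a with _ | a
    · have : V = ⊥ := by
        rw [eq_bot_iff]
        intro x hx
        simpa using (hV x hx).1
      exact this ▸ Submodule.fg_bot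
    rcases b with _ | b
    · have : V = ⊥ := by
        rw [eq_bot_iff]
        intro x hx
        simpa using (hV x hx).2
      exact this ▸ Submodule.fg_bot
    refine Submodule.fg_of_fg_map_of_fg_inf_ker (innerDer k f) ?_ (hf.of_le inf_le_right)
    have hL : (V.map (LinearMap.mulLeft k g)).FG := by
      refine ih a (b + 1) (by omega) _ ?_
      rintro _ ⟨x, hx, rfl⟩
      have := hV x hx
      simp only [LinearMap.mulLeft_apply]
      refine ⟨by rw [← mul_assoc, ← pow_succ]; exact this.1, by rw [mul_assoc, this.2, mul_zero]⟩
    have hR : (V.map (LinearMap.mulRight k g)).FG := by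
      refine ih (a + 1) b (by omega) _ ?_
      rintro _ ⟨x, hx, rfl⟩
      have := hV x hx
      simp only [LinearMap.mulRight_apply]
      refine ⟨by rw [← mul_assoc, this.1, zero_mul], by rw [mul_assoc, ← pow_succ']; exact this.2⟩
    refine (hL.sup hR).of_le ?_
    rintro _ ⟨x, hx, rfl⟩
    rw [hD]
    exact Submodule.sub_mem _ (Submodule.mem_sup_left ⟨x, hx, rfl⟩)
      (Submodule.mem_sup_right ⟨x, hx, rfl⟩)

lemma corner_fg_of_pow_mul_eq_zero {f u : A} (hf : (LinearMap.ker (innerDer k f)).FG) (c : k)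
    (n : ℕ) (hfu : Commute f u) (hu : (f - algebraMap k A c) ^ n * u = 0) :
    (corner k u).FG := by
  refine fg_of_pow_mul_eq_zero hf c (n + n) n n rfl _ fun x hx => ?_
  obtain ⟨y, rfl⟩ := mem_corner.1 hx
  have hc : Commute ((f - algebraMap k A c) ^ n) u :=
    ((hfu.sub_left (Algebra.commutes c u)).pow_left n)
  refine ⟨by rw [← mul_assoc, hu, zero_mul], ?_⟩
  rw [mul_assoc, mul_assoc, ← hc.eq, hu, mul_zero, mul_zero]

open Polynomial in
-- The cofactors of the powers `(X - c) ^ n c` are jointly coprime, so a Bézout identity evaluated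
-- at `f` writes 1 through elements killed by a power of some `f - c`; these have finite-dimensional
-- corners.
lemma finite_of_prod_eq_zero [Algebra.FiniteType k A] {f : A} (s : Finset k) (n : k → ℕ)
    (hpf : aeval f (∏ c ∈ s, (X - C c) ^ n c) = 0)
    (hf : (LinearMap.ker (innerDer k f)).FG) : Module.Finite k A := by
  classical
  rcases subsingleton_or_nontrivial A with h | h
  · infer_instance
  have hne : s.Nonempty := by
    rw [Finset.nonempty_iff_ne_empty]
    rintro rfl
    rw [Finset.prod_empty, map_one] at hpf
    exact one_ne_zero hpf
  have hcop : Pairwise fun c d : s => IsCoprime ((X - C c.1) ^ n c.1) ((X - C d.1) ^ n d.1) := by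
    intro c d hcd
    exact (isCoprime_X_sub_C_of_isUnit_sub
      (sub_ne_zero.2 fun h => hcd (Subtype.ext h)).isUnit).pow
  obtain ⟨μ, hμ⟩ := (exists_sum_eq_one_iff_pairwise_coprime
    (s := fun c => (X - C c) ^ n c) hne).2 hcop
  refine finite_of_sum_mul_eq_one s
    (fun c => aeval f (∏ d ∈ s \ {c}, (X - C d) ^ n d)) (fun c => aeval f (μ c)) ?_ ?_
  · intro c hc
    refine corner_fg_of_pow_mul_eq_zero hf c (n c) ?_ ?_
    · have := Commute.map (Commute.all (X : k[X]) (∏ d ∈ s \ {c}, (X - C d) ^ n d)) (aeval f)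
      rwa [aeval_X] at this
    · have : (f - algebraMap k A c) ^ n c = aeval f ((X - C c) ^ n c) := by simp
      rw [this, ← map_mul, ← hpf,
        ← Finset.prod_eq_mul_prod_sdiff_singleton c (fun d => (X - C d) ^ n d) fun h => (h hc).elim]
  · have := congrArg (aeval f) hμ
    simpa only [map_sum, map_mul, map_one] using this

open Polynomial in
lemma finite_of_ker_innerDer_fg_of_splits [Algebra.FiniteType k A] {f : A} {p : k[X]}
    (hp : p.Monic) (hs : p.Splits) (hpf : aeval f p = 0)
    (hf : (LinearMap.ker (innerDer k f)).FG) : Module.Finite k A := by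
  classical
  refine finite_of_prod_eq_zero p.roots.toFinset (fun c => p.roots.count c) ?_ hf
  rw [← Finset.prod_multiset_map_count, ← hpf]
  congr 1
  conv_rhs => rw [hs.eq_prod_roots, hp.leadingCoeff, C_1, one_mul]

open Polynomial in
/-- A finitely generated algebra in which some integral element has a finite-dimensional
centralizer is finite-dimensional. -/
lemma finite_of_ker_innerDer_fg [hA : Algebra.FiniteType k A] {f : A} (hi : IsIntegral k f)
    (hf : (LinearMap.ker (innerDer k f)).FG) : Module.Finite k A := by
  -- Over `K` the polynomial splits. Flatness carries the centralizer along, and faithful flatness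
  -- brings finiteness back.
  let K := AlgebraicClosure k
  obtain ⟨p, hp, hpf⟩ := hi
  have hft : Algebra.FiniteType K (K ⊗[k] A) := by
    obtain ⟨s, hs⟩ := hA.out
    exact ⟨(Subalgebra.fg_def).2 ⟨_, s.finite_toSet.image _,
      Algebra.TensorProduct.adjoin_one_tmul_image_eq_top (A := K) _ hs⟩⟩
  have hfin : Module.Finite K (K ⊗[k] A) := by
    refine finite_of_ker_innerDer_fg_of_splits (f := 1 ⊗ₜ f) (hp.map (algebraMap k K))
      (IsAlgClosed.splits _) ?_ ?_
    · have h := congrArg (Algebra.TensorProduct.includeRight : A →ₐ[k] K ⊗[k] A) hpf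
      rw [map_zero, ← aeval_def, ← aeval_algHom_apply] at h
      rwa [aeval_map_algebraMap]
    · have h1 : innerDer K ((1 : K) ⊗ₜ[k] f) =
          TensorProduct.AlgebraTensorModule.lTensor K K (innerDer k f) := by
        ext x
        simp [TensorProduct.tmul_sub]
      rw [h1, Module.Flat.ker_lTensor_eq]
      have : Module.Finite k (LinearMap.ker (innerDer k f)) := Module.Finite.iff_fg.2 hf
      exact Module.Finite.iff_fg.1 inferInstance
  exact Module.Finite.of_finite_tensorProduct_of_faithfullyFlat K

end Centralizer

/-! ### Simple subalgebras and polynomials over them. -/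

section Simple

open Polynomial in
/-- If a nonzero polynomial over a simple finite-dimensional subalgebra `M` vanishes at an element
`c` commuting with `M`, and `M` and `c` generate `A`, then `A` is finite-dimensional. -/
lemma finite_of_eval₂_eq_zero {k A : Type*} [Field k] [Ring A] [Algebra k A] {M : Subalgebra k A}
    [Module.Finite k M] [IsSimpleRing M] {c : A} (hc : ∀ m : M, Commute ((M.val : M →+* A) m) c)
    (hsurj : Function.Surjective (eval₂RingHom' (M.val : M →+* A) c hc)) {p : M[X]} (hp : p ≠ 0)
    (hpc : eval₂RingHom' (M.val : M →+* A) c hc p = 0) : Module.Finite k A := by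
  set ψ := eval₂RingHom' (M.val : M →+* A) c hc with hψ
  let n := p.natDegree
  -- The `n`-th coefficients of relations of degree at most `n` form a nonzero ideal of `M`, hence
  -- all of `M`. So there is a monic relation, and division by it bounds the dimension of `A`.
  let J : TwoSidedIdeal M := TwoSidedIdeal.mk'
    {m | ∃ q : M[X], ψ q = 0 ∧ q.natDegree ≤ n ∧ q.coeff n = m}
    ⟨0, by simp⟩
    (by
      rintro _ _ ⟨q, hq, hqn, rfl⟩ ⟨r, hr, hrn, rfl⟩
      exact ⟨q + r, by simp [hq, hr], natDegree_add_le_of_degree_le hqn hrn, by simp⟩)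
    (by
      rintro _ ⟨q, hq, hqn, rfl⟩
      exact ⟨-q, by rw [map_neg, hq, neg_zero], by simpa using hqn, by simp⟩)
    (by
      rintro m _ ⟨q, hq, hqn, rfl⟩
      exact ⟨C m * q, by rw [map_mul, hq, mul_zero], (natDegree_C_mul_le _ _).trans hqn, by simp⟩)
    (by
      rintro _ m ⟨q, hq, hqn, rfl⟩
      exact ⟨q * C m, by rw [map_mul, hq, zero_mul], (natDegree_mul_C_le _ _).trans hqn, by simp⟩)
  have hJ : (1 : M) ∈ J := by
    refine IsSimpleRing.one_mem_of_ne_zero_mem J (leadingCoeff_ne_zero.2 hp) ?_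
    rw [TwoSidedIdeal.mem_mk']
    exact ⟨p, hpc, le_rfl, rfl⟩
  rw [TwoSidedIdeal.mem_mk'] at hJ
  obtain ⟨q, hq, hqn, hq1⟩ := hJ
  have hmonic : q.Monic := monic_of_natDegree_le_of_coeff_eq_one n hqn hq1
  let e : (Fin (n + 1) → M) →ₗ[k] A :=
    ∑ i : Fin (n + 1), (LinearMap.mulRight k (c ^ (i : ℕ)) ∘ₗ M.val.toLinearMap) ∘ₗ
      LinearMap.proj i
  refine Module.Finite.of_surjective e fun x => ?_
  obtain ⟨r, rfl⟩ := hsurj x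
  have hr : ψ r = ψ (r %ₘ q) := by
    conv_lhs => rw [← modByMonic_add_div r q, map_add, map_mul, hq, zero_mul, add_zero]
  refine ⟨fun i => (r %ₘ q).coeff i, ?_⟩
  rw [hr]
  have hdeg : (r %ₘ q).natDegree < n + 1 :=
    Nat.lt_succ_of_le ((natDegree_modByMonic_le _ hmonic).trans hqn)
  rw [hψ]
  change _ = eval₂ (M.val : M →+* A) c (r %ₘ q)
  rw [eval₂_eq_sum_range' _ hdeg, ← Fin.sum_univ_eq_sum_range
    (fun i => (M.val : M →+* A) ((r %ₘ q).coeff i) * c ^ i)]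
  simp [e]

open Polynomial in
/-- If `M` is a simple finite-dimensional maximal subalgebra which does not contain its
centralizer, then `A` is finite-dimensional. -/
lemma finite_of_commute {k A : Type*} [Field k] [Ring A] [Algebra k A] {M : Subalgebra k A}
    (hM : IsCoatom M) [Module.Finite k M] [IsSimpleRing M] {c : A} (hcM : c ∉ M)
    (hc : ∀ m ∈ M, m * c = c * m) : Module.Finite k A := by
  have hc' : ∀ m : M, Commute ((M.val : M →+* A) m) c := fun m => hc _ m.2
  have range_eq : ∀ d : A, d ∉ M → ∀ hd : ∀ m : M, Commute ((M.val : M →+* A) m) d,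
      Function.Surjective (eval₂RingHom' (M.val : M →+* A) d hd) := by
    intro d hdM hd
    let S : Subalgebra k A :=
      { (eval₂RingHom' (M.val : M →+* A) d hd).range with
        algebraMap_mem' := fun r => ⟨C (algebraMap k M r), by
          change eval₂ _ _ _ = _
          rw [eval₂_C]; rfl⟩ }
    have hMS : M ≤ S := fun m hm => ⟨C ⟨m, hm⟩, by
      change eval₂ _ _ _ = _
      rw [eval₂_C]; rfl⟩
    have hdS : d ∈ S := ⟨X, eval₂_X _ _⟩
    have hS : S = ⊤ := hM.2 S (lt_of_le_of_ne hMS fun h => hdM (h ▸ hdS))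
    intro x
    have : x ∈ S := hS ▸ Algebra.mem_top
    exact this
  by_cases h2 : c ^ 2 ∈ M
  · refine finite_of_eval₂_eq_zero hc' (range_eq c hcM hc') (p := X ^ 2 - C ⟨c ^ 2, h2⟩)
      (X_pow_sub_C_ne_zero two_pos _) ?_
    rw [map_sub, sub_eq_zero]
    change eval₂ _ _ _ = eval₂ _ _ _
    rw [eval₂_X_pow, eval₂_C]
    rfl
  -- By maximality `c² ∉ M` gives `A = M[c²]`, so `c = q(c²)`. The relation `X - q(X²)` is nonzero
  -- since `q(X²)` has no term of degree 1; `E` is the substitution `X ↦ X²`.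
  · obtain ⟨q, hq⟩ := range_eq (c ^ 2) h2 (fun m => (hc' m).pow_right 2) c
    let E : M[X] →+* M[X] := eval₂RingHom' C (X ^ 2) fun m => (commute_X_pow (C m) 2).symm
    have hE : ∀ r, (E r).coeff 1 = 0 := by
      intro r
      change (eval₂ C (X ^ 2) r).coeff 1 = 0
      rw [eval₂_eq_sum_range, finsetSum_coeff]
      refine Finset.sum_eq_zero fun i _ => ?_
      rw [← pow_mul, coeff_C_mul, coeff_X_pow, if_neg (by omega), mul_zero]
    have hψE : (eval₂RingHom' (M.val : M →+* A) c hc').comp E =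
        eval₂RingHom' (M.val : M →+* A) (c ^ 2) (fun m => (hc' m).pow_right 2) := by
      apply Polynomial.ringHom_ext
      · intro m
        simp [E, eval₂RingHom']
      · simp [E, eval₂RingHom']
    refine finite_of_eval₂_eq_zero hc' (range_eq c hcM hc') (p := X - E q) ?_ ?_
    · intro h
      have := congrArg (coeff · 1) h
      simp [hE] at this
    · rw [map_sub, sub_eq_zero, ← RingHom.comp_apply, hψE, hq]
      change eval₂ _ _ _ = _
      rw [eval₂_X]

/-- A semisimple ring without nontrivial central idempotents is simple. -/
lemma isSimpleRing_of_central_idempotents {R : Type*} [Ring R] [Nontrivial R] [IsSemisimpleRing R]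
    (h : ∀ e : R, e * e = e → (∀ x, e * x = x * e) → e = 0 ∨ e = 1) : IsSimpleRing R := by
  classical
  obtain ⟨n, D, d, _, hd, ⟨φ⟩⟩ := IsSemisimpleRing.exists_ringEquiv_pi_matrix_divisionRing R
  rcases n with _ | n
  · exact absurd φ.toEquiv.subsingleton (not_subsingleton R)
  · have hn : n = 0 := by
      by_contra hn
      let e : ∀ i : Fin (n + 1), Matrix (Fin (d i)) (Fin (d i)) (D i) := Pi.single 0 1
      have he : e * e = e := by rw [← Pi.single_mul, mul_one]
      have hc : ∀ x, e * x = x * e := by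
        intro x
        ext1 i
        rcases eq_or_ne i 0 with rfl | hi
        · simp [e]
        · simp [e, hi]
      have h01 := h (φ.symm e) (by rw [← map_mul, he]) fun x => by
        apply φ.injective
        simp [hc]
      rcases h01 with h0 | h1
      · rw [EmbeddingLike.map_eq_zero_iff] at h0
        have := congrFun h0 0
        have hne := hd 0
        simp [e] at this
      · rw [EmbeddingLike.map_eq_one_iff] at h1
        have := congrFun h1 (Fin.last n)
        have hl : Fin.last n ≠ 0 := by simpa [Fin.ext_iff] using hn
        have hne := hd (Fin.last n)
        simp [e, hl] at this
    subst hn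
    have := hd 0
    let ψ : R ≃+* Matrix (Fin (d 0)) (Fin (d 0)) (D 0) := φ.trans (RingEquiv.piUnique
      fun i : Fin 1 => Matrix (Fin (d i)) (Fin (d i)) (D i))
    exact IsSimpleRing.of_ringEquiv ψ.symm inferInstance

end Simple

/-! ### Central simple algebras and their centralizers. -/

section CentralSimple

open scoped TensorProduct

variable {K B : Type*} [Field K] [Ring B] [Algebra K B] [IsSimpleRing B] [Algebra.IsCentral K B]

/-- Shortest-relation argument. By simplicity some relation `q` supported in `s` has `q j = 1`. Each
commutator `rq - qr` is a relation with smaller support, hence 0, so all `q i` are scalars; `x = 1`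
then contradicts independence. -/
lemma eq_zero_of_sum_mul_mul_eq_zero {ι : Type*} [Fintype ι] {b : ι → B}
    (hb : LinearIndependent K b) (s : Finset ι) : ∀ a : ι → B, (∀ i ∉ s, a i = 0) →
      (∀ x, ∑ i, a i * x * b i = 0) → a = 0 := by
  classical
  induction s using Finset.strongInduction with
  | H s ih =>
    intro a has ha
    by_contra hne
    obtain ⟨j, hj⟩ := Function.ne_iff.1 hne
    let J : TwoSidedIdeal B := TwoSidedIdeal.mk'
      {m | ∃ q : ι → B, (∀ i ∉ s, q i = 0) ∧ (∀ x, ∑ i, q i * x * b i = 0) ∧ q j = m}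
      ⟨0, by simp⟩
      (by
        rintro _ _ ⟨q, hq, hqn, rfl⟩ ⟨r, hr, hrn, rfl⟩
        exact ⟨q + r, fun i hi => by simp [hq i hi, hr i hi],
          fun x => by simp [add_mul, Finset.sum_add_distrib, hqn, hrn], rfl⟩)
      (by
        rintro _ ⟨q, hq, hqn, rfl⟩
        exact ⟨-q, fun i hi => by simp [hq i hi], fun x => by simp [hqn], rfl⟩)
      (by
        rintro m _ ⟨q, hq, hqn, rfl⟩
        refine ⟨fun i => m * q i, fun i hi => by simp [hq i hi], fun x => ?_, rfl⟩
        simp only [mul_assoc, ← Finset.mul_sum] at hqn ⊢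
        rw [hqn, mul_zero])
      (by
        rintro _ m ⟨q, hq, hqn, rfl⟩
        refine ⟨fun i => q i * m, fun i hi => by simp [hq i hi], fun x => ?_, rfl⟩
        simpa only [mul_assoc] using hqn (m * x))
    have hJ : (1 : B) ∈ J := by
      refine IsSimpleRing.one_mem_of_ne_zero_mem J hj ?_
      rw [TwoSidedIdeal.mem_mk']
      exact ⟨a, has, ha, rfl⟩
    rw [TwoSidedIdeal.mem_mk'] at hJ
    obtain ⟨q, hqs, hq, hqj⟩ := hJ
    have hjs : j ∈ s := by
      by_contra h
      rw [hqs j h] at hqj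
      exact zero_ne_one hqj
    have hcomm : ∀ r : B, (fun i => r * q i - q i * r) = 0 := by
      intro r
      refine ih (s.erase j) (Finset.erase_ssubset hjs) _ (fun i hi => ?_) fun x => ?_
      · by_cases hij : i = j
        · subst hij
          simp [hqj]
        · simp [hqs i fun h => hi (Finset.mem_erase.2 ⟨hij, h⟩)]
      · have h1 := hq x
        have h2 := hq (r * x)
        simp only [mul_assoc, sub_mul, Finset.sum_sub_distrib, ← Finset.mul_sum] at h1 h2 ⊢
        rw [h1, h2, mul_zero, sub_zero]
    have hcen : ∀ i, ∃ y : K, q i = algebraMap K B y := fun i =>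
      (Algebra.IsCentral.mem_center_iff K).1 (Subalgebra.mem_center_iff.2 fun r =>
        sub_eq_zero.1 (congrFun (hcomm r) i))
    choose y hy using hcen
    have hlin : ∑ i, y i • b i = 0 := by
      have := hq 1
      simpa only [mul_one, hy, ← Algebra.smul_def] using this
    have := Fintype.linearIndependent_iff.1 hb y hlin j
    rw [hy, this, map_zero] at hqj
    exact zero_ne_one hqj

variable [Module.Finite K B]

lemma mulLeftRight_bijective : Function.Bijective (AlgHom.mulLeftRight K B) := by
  classical
  have hinj : Function.Injective (AlgHom.mulLeftRight K B) := by
    rw [injective_iff_map_eq_zero]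
    intro t ht
    let b := Module.finBasis K B
    let b' : Module.Basis _ K Bᵐᵒᵖ := b.map (MulOpposite.opLinearEquiv K)
    have hrep : ∀ t : B ⊗[K] Bᵐᵒᵖ, ∃ a : Fin (Module.finrank K B) → B,
        t = ∑ i, a i ⊗ₜ b' i := by
      intro t
      induction t using TensorProduct.induction_on with
      | zero => exact ⟨0, by simp⟩
      | tmul x y =>
        refine ⟨fun i => b'.repr y i • x, ?_⟩
        conv_lhs => rw [← b'.sum_repr y, TensorProduct.tmul_sum]
        simp [TensorProduct.smul_tmul]
      | add x y hx hy =>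
        obtain ⟨a, rfl⟩ := hx
        obtain ⟨a', rfl⟩ := hy
        exact ⟨a + a', by simp [TensorProduct.add_tmul, Finset.sum_add_distrib]⟩
    obtain ⟨a, rfl⟩ := hrep t
    have : a = 0 := by
      refine eq_zero_of_sum_mul_mul_eq_zero b.linearIndependent Finset.univ a (by simp) fun x => ?_
      have := LinearMap.congr_fun ht x
      simpa [b'] using this
    simp [this]
  refine ⟨hinj, ?_⟩
  refine (LinearMap.injective_iff_surjective_of_finrank_eq_finrank
    (f := (AlgHom.mulLeftRight K B).toLinearMap) ?_).1 hinj
  rw [Module.finrank_tensorProduct, Module.finrank_linearMap,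
    ← (MulOpposite.opLinearEquiv K (M := B)).finrank_eq]

/-- An algebra over `K` containing a central simple algebra `B` is generated by `B` and the
centralizer of `B`. -/
lemma exists_sum_mul_of_isCentral {A : Type*} [Ring A] [Algebra K A] (φ : B →ₐ[K] A) (x : A) :
    ∃ (n : ℕ) (b : Fin n → B) (c : Fin n → A), (∀ i m, φ m * c i = c i * φ m) ∧
      x = ∑ i, φ (b i) * c i := by
  classical
  let Φ : B ⊗[K] Bᵐᵒᵖ →ₐ[K] Module.End K A :=
    (AlgHom.mulLeftRight K A).comp (Algebra.TensorProduct.map φ (AlgHom.op φ))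
  have hΦ : ∀ a b y, Φ (a ⊗ₜ b) y = φ a * y * φ b.unop := by
    intro a b y
    simp [Φ]
  let b := Module.finBasis K B
  -- `t i` acts on `B` as `y ↦ (b.coord i y) • 1`. Thus `(m ⊗ 1) t i = (1 ⊗ m) t i`, which puts `t
  -- i` applied to `x` in the centralizer, and `∑ (b i ⊗ 1) t i = 1` recovers `x`.
  choose t ht using fun i => (mulLeftRight_bijective (K := K) (B := B)).2
    (LinearMap.toSpanSingleton K B 1 ∘ₗ b.coord i)
  refine ⟨_, b, fun i => Φ (t i) x, fun i m => ?_, ?_⟩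
  · have : (m ⊗ₜ 1) * t i = (1 ⊗ₜ MulOpposite.op m) * t i := by
      apply (mulLeftRight_bijective (K := K) (B := B)).1
      ext y
      simp [ht]
    have := congrArg (fun s => Φ s x) this
    simpa [hΦ] using this
  · have : ∑ i, (b i ⊗ₜ 1) * t i = 1 := by
      apply (mulLeftRight_bijective (K := K) (B := B)).1
      ext y
      simp only [map_sum, map_mul, ht, map_one]
      simp only [LinearMap.sum_apply, Module.End.mul_apply, AlgHom.mulLeftRight_apply]
      simp [b.sum_repr]
    have := congrArg (fun s => Φ s x) this
    simpa [hΦ] using this.symm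

end CentralSimple

/-! ### Finite-dimensional maximal subalgebras containing no nonzero ideal. -/

section Core

variable {k A : Type*} [Field k] [Ring A] [Algebra k A] {M : Subalgebra k A}

lemma finiteType_of_isCoatom (hM : IsCoatom M) [Module.Finite k M] : Algebra.FiniteType k A := by
  obtain ⟨x, hx⟩ : ∃ x, x ∉ M := by
    by_contra! h
    exact hM.1 (eq_top_iff.2 fun x _ => h x)
  obtain ⟨s, hs⟩ : M.toSubmodule.FG := Module.Finite.iff_fg.1 ‹Module.Finite k M›
  refine ⟨Subalgebra.fg_def.2 ⟨insert x s, s.finite_toSet.insert x, hM.2 _ ?_⟩⟩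
  refine lt_of_le_of_ne (fun m hm => ?_)
    fun h => hx (h ▸ Algebra.subset_adjoin (Set.mem_insert _ _))
  have : m ∈ Submodule.span k (s : Set A) := hs ▸ hm
  exact Algebra.span_le_adjoin k _ (Submodule.span_mono (Set.subset_insert _ _) this)

lemma le_or_sup_eq_top (hM : IsCoatom M) {N : Submodule k A} (hMN : M.toSubmodule * N ≤ N)
    (hNM : N * M.toSubmodule ≤ N) (hNN : N * N ≤ N) :
    N ≤ M.toSubmodule ∨ M.toSubmodule ⊔ N = ⊤ := by
  have hMM : M.toSubmodule * M.toSubmodule ≤ M.toSubmodule :=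
    Submodule.mul_le.2 fun x hx y hy => M.mul_mem hx hy
  have hS : (M.toSubmodule ⊔ N) * (M.toSubmodule ⊔ N) ≤ M.toSubmodule ⊔ N := by
    simp only [Submodule.sup_mul, Submodule.mul_sup]
    exact sup_le (sup_le (hMM.trans le_sup_left) (hNM.trans le_sup_right))
      (sup_le (hMN.trans le_sup_right) (hNN.trans le_sup_right))
  let S : Subalgebra k A := (M.toSubmodule ⊔ N).toSubalgebra (Submodule.mem_sup_left M.one_mem)
    fun x y hx hy => hS (Submodule.mul_mem_mul hx hy)
  have hMS : M ≤ S := fun m hm => Submodule.mem_sup_left (S := M.toSubmodule) hm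
  rcases hM.le_iff.1 hMS with h | h
  · right
    rw [eq_top_iff]
    intro x _
    have : x ∈ S := h ▸ Algebra.mem_top
    exact this
  · left
    intro x hx
    have : x ∈ S := Submodule.mem_sup_right hx
    rw [h] at this
    exact this

lemma sup_eq_top_of_isBiIdeal (hM : IsCoatom M)
    (hcore : ∀ I : Submodule k A, IsBiIdeal I → I ≤ M.toSubmodule → I = ⊥)
    {I : Submodule k A} (hI : IsBiIdeal I) (h0 : I ≠ ⊥) : M.toSubmodule ⊔ I = ⊤ := by
  refine (le_or_sup_eq_top hM ?_ ?_ ?_).resolve_left fun h => h0 (hcore I hI h)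
  · exact Submodule.mul_le.2 fun m _ x hx => (hI x hx m).1
  · exact Submodule.mul_le.2 fun x hx m _ => (hI x hx m).2
  · exact Submodule.mul_le.2 fun x _ y hy => (hI y hy x).1

/-- Let `P = NAN`. If `P` is not in `M`, then `A = M + P` and `P = N(M + P)N ≤ NN = 0`. So `P ≤ M`
always, and any nonzero `n ∈ N` has `nAn` finite-dimensional; the ideal it generates is locally
finite and complements `M` to `A`. -/
lemma finite_or_eq_bot_of_mul_self_eq_bot (hM : IsCoatom M) [hf : Module.Finite k M]
    (hcore : ∀ I : Submodule k A, IsBiIdeal I → I ≤ M.toSubmodule → I = ⊥)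
    {N : Submodule k A} (hMN : M.toSubmodule * N ≤ N) (hNM : N * M.toSubmodule ≤ N)
    (hNN : N * N = ⊥) : Module.Finite k A ∨ N = ⊥ := by
  have hMfg : M.toSubmodule.FG := Module.Finite.iff_fg.1 hf
  have := finiteType_of_isCoatom hM
  by_cases hN : N = ⊥
  · exact Or.inr hN
  left
  set P := N * ⊤ * N with hP
  have hMP : M.toSubmodule * P ≤ P := by
    rw [hP, ← mul_assoc, ← mul_assoc]
    exact mul_le_mul_left (mul_le_mul_left hMN _) _
  have hPM : P * M.toSubmodule ≤ P := by
    rw [hP, mul_assoc _ N]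
    exact mul_le_mul_right hNM _
  have hPP : P * P ≤ P := by
    have : P * P = N * ⊤ * (N * N) * ⊤ * N := by simp only [hP, mul_assoc]
    rw [this, hNN]
    simp
  have hPleM : P ≤ M.toSubmodule := by
    rcases le_or_sup_eq_top hM hMP hPM hPP with h | h
    · exact h
    · have hNP : N * P = ⊥ := by rw [hP, ← mul_assoc, ← mul_assoc, hNN]; simp
      have : P ≤ ⊥ := by
        calc P = N * (M.toSubmodule ⊔ P) * N := by rw [h]
          _ = N * M.toSubmodule * N := by
            rw [Submodule.mul_sup, hNP, sup_bot_eq]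
          _ ≤ N * N := mul_le_mul_left hNM _
          _ = ⊥ := hNN
      exact this.trans bot_le
  obtain ⟨n, hn, hn0⟩ := Submodule.exists_mem_ne_zero_of_ne_bot hN
  have hcor : (corner k n).FG := by
    refine hMfg.of_le (le_trans ?_ hPleM)
    intro x hx
    obtain ⟨y, rfl⟩ := mem_corner.1 hx
    rw [← mul_assoc]
    exact Submodule.mul_mem_mul (Submodule.mul_mem_mul hn Submodule.mem_top) hn
  have hnI := le_top_mul_mul_top _ (Submodule.mem_span_singleton_self (R := k) n)
  exact (locFinite_of_corner_fg hcor).finite (isBiIdeal_top_mul_mul_top _) hMfg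
    (sup_eq_top_of_isBiIdeal hM hcore (isBiIdeal_top_mul_mul_top _) fun h => hn0 (by
      rw [h] at hnI
      exact hnI))

/-- A maximal finite-dimensional subalgebra containing no nonzero ideal of the algebra is
semisimple, unless the algebra is finite-dimensional. -/
lemma finite_or_isSemisimpleRing (hM : IsCoatom M) [Module.Finite k M]
    (hcore : ∀ I : Submodule k A, IsBiIdeal I → I ≤ M.toSubmodule → I = ⊥) :
    Module.Finite k A ∨ IsSemisimpleRing M := by
  have : IsArtinianRing M := IsArtinianRing.of_finite k M
  by_cases hA : Module.Finite k A
  · exact Or.inl hA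
  right
  have key : ∀ L : Ideal M, L.IsTwoSided → L * L = ⊥ → L = ⊥ := by
    intro L hL hLL
    let N : Submodule k A := (L.restrictScalars k).map M.val.toLinearMap
    have hN : N = ⊥ := by
      refine (finite_or_eq_bot_of_mul_self_eq_bot hM hcore (N := N) ?_ ?_ ?_).resolve_left hA
      · refine Submodule.mul_le.2 ?_
        rintro m hm _ ⟨x, hx, rfl⟩
        exact ⟨⟨m, hm⟩ * x, L.mul_mem_left _ hx, rfl⟩
      · refine Submodule.mul_le.2 ?_
        rintro _ ⟨x, hx, rfl⟩ m hm
        exact ⟨x * ⟨m, hm⟩, L.mul_mem_right _ hx, rfl⟩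
      · rw [eq_bot_iff]
        refine Submodule.mul_le.2 ?_
        rintro _ ⟨x, hx, rfl⟩ _ ⟨y, hy, rfl⟩
        have : x * y ∈ L * L := Ideal.mul_mem_mul hx hy
        rw [hLL, Submodule.mem_bot] at this
        change (x : A) * (y : A) = 0
        exact congrArg Subtype.val this
    rw [eq_bot_iff]
    intro x hx
    have : (x : A) ∈ N := ⟨x, hx, rfl⟩
    rw [hN, Submodule.mem_bot] at this
    exact Subtype.ext this
  rw [IsArtinianRing.isSemisimpleRing_iff_jacobson]
  obtain ⟨n, hn⟩ := IsSemiprimaryRing.isNilpotent (R := M)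
  induction n with
  | zero =>
    rw [eq_bot_iff]
    rw [Submodule.pow_zero, Ideal.one_eq_top] at hn
    exact le_top.trans hn.le
  | succ n ih =>
    rcases n with _ | n
    · rwa [zero_add, Submodule.pow_one] at hn
    · refine ih (key _ inferInstance ?_)
      rw [← Ideal.IsTwoSided.pow_add, eq_bot_iff]
      refine (Ideal.pow_le_pow_right ?_).trans hn.le
      omega

/-- The centralizer of `z` contains `M`, so it is `A` or `M`; in the second case it is
finite-dimensional, and `z` is integral. -/
lemma finite_or_central (hM : IsCoatom M) [hf : Module.Finite k M] {z : A} (hzM : z ∈ M)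
    (hz : ∀ m ∈ M, m * z = z * m) : Module.Finite k A ∨ ∀ a : A, a * z = z * a := by
  have := finiteType_of_isCoatom hM
  have hle : M ≤ Subalgebra.centralizer k {z} := fun m hm => by
    rw [Subalgebra.mem_centralizer_iff]
    rintro _ rfl
    exact (hz m hm).symm
  rcases hM.le_iff.1 hle with h | h
  · right
    intro a
    have : a ∈ Subalgebra.centralizer k {z} := h ▸ Algebra.mem_top
    exact ((Subalgebra.mem_centralizer_iff k).1 this z rfl).symm
  · left
    refine finite_of_ker_innerDer_fg (f := z) ?_ ?_
    · exact (Algebra.IsIntegral.isIntegral (R := k) (⟨z, hzM⟩ : M)).map M.val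
    · refine (Module.Finite.iff_fg.1 hf : M.toSubmodule.FG).of_le fun x hx => ?_
      have hx' : x ∈ Subalgebra.centralizer k {z} := by
        rw [Subalgebra.mem_centralizer_iff]
        rintro _ rfl
        simpa [sub_eq_zero] using hx
      rw [h] at hx'
      exact hx'

lemma finite_or_isSimpleRing (hM : IsCoatom M) [Module.Finite k M]
    (hcore : ∀ I : Submodule k A, IsBiIdeal I → I ≤ M.toSubmodule → I = ⊥) :
    Module.Finite k A ∨ IsSimpleRing M := by
  by_cases hA : Module.Finite k A
  · exact Or.inl hA
  right
  have := (finite_or_isSemisimpleRing hM hcore).resolve_left hA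
  have : Nontrivial A := by
    by_contra h
    rw [not_nontrivial_iff_subsingleton] at h
    exact hA inferInstance
  refine isSimpleRing_of_central_idempotents fun e he hc => ?_
  by_contra! h01
  have hcA : ∀ a : A, a * e = e * a :=
    (finite_or_central hM e.2 fun m hm => congrArg Subtype.val (hc ⟨m, hm⟩).symm).resolve_left hA
  have heA : (e : A) * e = e := congrArg Subtype.val he
  -- Since `A = M + fA` and `gf = 0`, one gets `gA = gM ≤ M`. Applied to `e` and `1 - e`, this
  -- forces `A = M`.
  have key : ∀ f g : M, f ≠ 0 → (∀ a : A, a * f = f * a) → (g : A) * f = 0 →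
      ∀ a : A, g * a ∈ M := by
    intro f g hf hfc hgf a
    let I : Submodule k A := LinearMap.range (LinearMap.mulLeft k (f : A))
    have hI : IsBiIdeal I := by
      rintro _ ⟨x, rfl⟩ b
      simp only [LinearMap.mulLeft_apply]
      exact ⟨⟨b * x, by simp only [LinearMap.mulLeft_apply]; rw [← mul_assoc, ← hfc, mul_assoc]⟩,
        ⟨x * b, by simp [mul_assoc]⟩⟩
    have hI0 : I ≠ ⊥ := by
      intro h
      have : (f : A) ∈ I := ⟨1, by simp⟩
      rw [h, Submodule.mem_bot] at this
      exact hf (Subtype.ext this)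
    have ha : a ∈ M.toSubmodule ⊔ I := by
      rw [sup_eq_top_of_isBiIdeal hM hcore hI hI0]; trivial
    obtain ⟨m, hm, _, ⟨x, rfl⟩, rfl⟩ := Submodule.mem_sup.1 ha
    rw [mul_add, LinearMap.mulLeft_apply, ← mul_assoc (g : A), hgf, zero_mul, add_zero]
    exact M.mul_mem g.2 hm
  apply hM.1
  rw [eq_top_iff]
  intro a _
  have h1 : ((1 - e : M) : A) * a ∈ M := key e (1 - e) h01.1 hcA (by simp [sub_mul, heA]) a
  have h2 : (e : A) * a ∈ M := key (1 - e) e (sub_ne_zero.2 (Ne.symm h01.2))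
    (fun a => by simp [mul_sub, sub_mul, hcA]) (by simp [mul_sub, heA]) a
  have := M.add_mem h1 h2
  rwa [← add_mul, show ((1 - e : M) : A) + e = 1 by simp, one_mul] at this

/-- The center of a simple algebra is a field. -/
lemma exists_field_center.{v, w} (k : Type v) (R : Type w) [Field k] [Ring R] [Algebra k R] [IsSimpleRing R] :
    ∃ (F : Type w) (_ : Field F) (j : k →+* F) (e : F →+* R), (∀ r, algebraMap k R r = e (j r)) ∧
      (∀ z x, e z * x = x * e z) ∧ ∀ z : R, (∀ x, x * z = z * x) → ∃ y, e y = z := by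
  have hF : IsField (Subalgebra.center k R) := IsSimpleRing.isField_center R
  let _ : Field (Subalgebra.center k R) := hF.toField
  exact ⟨Subalgebra.center k R, inferInstance, algebraMap k _, (Subalgebra.center k R).val,
    fun _ => rfl, fun z x => (Subalgebra.mem_center_iff.1 z.2 x).symm,
    fun z hz => ⟨⟨z, Subalgebra.mem_center_iff.2 hz⟩, rfl⟩⟩

lemma finite_of_isCoatom_of_core (hM : IsCoatom M) [Module.Finite k M]
    (hcore : ∀ I : Submodule k A, IsBiIdeal I → I ≤ M.toSubmodule → I = ⊥) :
    Module.Finite k A := by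
  by_contra hA
  have := (finite_or_isSimpleRing hM hcore).resolve_left hA
  have hC : ∀ c : A, (∀ m ∈ M, m * c = c * m) → c ∈ M := fun c hc => by
    by_contra hcM
    exact hA (finite_of_commute hM hcM hc)
  obtain ⟨F, _, j, e, hej, hec, hce⟩ := exists_field_center k M
  let _ : Algebra k F := j.toAlgebra
  let _ : Algebra F M := e.toAlgebra' hec
  have : IsScalarTower k F M := IsScalarTower.of_algebraMap_eq hej
  -- `A` becomes an `F`-algebra because the center of `M` is central in `A`, by `finite_or_central`.
  let _ : Algebra F A := ((M.val : M →+* A).comp e).toAlgebra' fun z a =>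
    (((finite_or_central hM (e z).2 fun m hm => congrArg Subtype.val
      (hec z ⟨m, hm⟩).symm).resolve_left hA) a).symm
  have : Module.Finite F M := Module.Finite.of_restrictScalars_finite k F M
  have : Algebra.IsCentral F M := ⟨fun z hz => by
    obtain ⟨y, rfl⟩ := hce z (Subalgebra.mem_center_iff.1 hz)
    exact Algebra.mem_bot.2 ⟨y, rfl⟩⟩
  let φ : M →ₐ[F] A := { (M.val : M →+* A) with commutes' := fun z => rfl }
  apply hM.1
  rw [eq_top_iff]
  intro x _
  obtain ⟨n, b, c, hc, rfl⟩ := exists_sum_mul_of_isCentral φ x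
  exact M.sum_mem fun i _ => M.mul_mem (b i).2 (hC _ fun m hm => hc i ⟨m, hm⟩)

end Core

/-- An algebra with a finite-dimensional maximal subalgebra is finite-dimensional. -/
theorem finite_of_isCoatom {k : Type*} [Field k] (n : ℕ) : ∀ {A : Type*} [Ring A] [Algebra k A]
    {M : Subalgebra k A}, IsCoatom M → Module.Finite k M → Module.finrank k M ≤ n →
    Module.Finite k A := by
  induction n with
  | zero =>
    intro A _ _ M hM _ hn
    refine finite_of_isCoatom_of_core hM fun I _ hI => ?_
    rw [eq_bot_iff]
    refine hI.trans (le_of_eq ?_)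
    exact Submodule.finrank_eq_zero.1 (Nat.le_zero.1 hn)
  | succ n ih =>
    intro A _ _ M hM hf hn
    by_cases hcore : ∀ I : Submodule k A, IsBiIdeal I → I ≤ M.toSubmodule → I = ⊥
    · exact finite_of_isCoatom_of_core hM hcore
    push Not at hcore
    obtain ⟨I, hI, hIM, hI0⟩ := hcore
    -- In `A ⧸ J` the image of `M` is still maximal and has smaller dimension. Finiteness lifts back
    -- because `I ≤ M` is finite-dimensional.
    let J : Ideal A := { I with smul_mem' := fun a x hx => (hI x hx a).1 }
    have : J.IsTwoSided := ⟨fun {x} a hx => (hI x hx a).2⟩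
    let π : A →ₐ[k] A ⧸ J := Ideal.Quotient.mkₐ k J
    have hπ : Function.Surjective π := Ideal.Quotient.mk_surjective
    have hker : LinearMap.ker π.toLinearMap = I := by
      ext x
      exact Ideal.Quotient.eq_zero_iff_mem (I := J)
    have hcomap : (M.map π).comap π = M := by
      refine le_antisymm ?_ fun m hm => ⟨m, hm, rfl⟩
      rintro x ⟨m, hm, hmx⟩
      have : x - m ∈ I := by
        rw [← hker]
        simpa [sub_eq_zero] using hmx.symm
      simpa using M.add_mem (hIM this) hm
    have hcoatom : IsCoatom (M.map π) := by
      constructor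
      · intro h
        apply hM.1
        rw [← hcomap, h]
        rfl
      · intro S hS
        have hlt : M < S.comap π := by
          refine lt_of_le_of_ne ?_ fun h => ?_
          · rw [← hcomap]
            exact fun x hx => hS.le hx
          · refine hS.not_ge fun y hy => ?_
            obtain ⟨x, rfl⟩ := hπ y
            have : x ∈ M := h ▸ hy
            exact ⟨x, this, rfl⟩
        have := hM.2 _ hlt
        rw [eq_top_iff]
        intro y _
        obtain ⟨x, rfl⟩ := hπ y
        have hx : x ∈ S.comap π := this ▸ Algebra.mem_top
        exact hx
    have hMfg : M.toSubmodule.FG := Module.Finite.iff_fg.1 hf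
    have hIfg : I.FG := hMfg.of_le hIM
    have hfin : Module.Finite k (M.map π) :=
      Module.Finite.iff_fg.2 (hMfg.map π.toLinearMap)
    have hrank : Module.finrank k (M.map π) < Module.finrank k M := by
      let g : M →ₗ[k] M.map π := (π.toLinearMap.submoduleMap M.toSubmodule)
      have hg : Function.Surjective g := π.toLinearMap.submoduleMap_surjective M.toSubmodule
      have h1 := LinearMap.finrank_range_add_finrank_ker g
      rw [LinearMap.range_eq_top.2 hg, finrank_top] at h1
      have : 0 < Module.finrank k (LinearMap.ker g) := by
        rw [Module.finrank_pos_iff_exists_ne_zero]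
        obtain ⟨x, hx, hx0⟩ := Submodule.exists_mem_ne_zero_of_ne_bot hI0
        refine ⟨⟨⟨x, hIM hx⟩, Subtype.ext ?_⟩, fun h => hx0 ?_⟩
        · rw [← hker] at hx
          exact hx
        · exact congrArg (fun y : LinearMap.ker g => ((y : M) : A)) h
      omega
    have hquot : Module.Finite k (A ⧸ J) := ih hcoatom hfin (by omega)
    refine ⟨Submodule.fg_of_fg_map_of_fg_inf_ker π.toLinearMap ?_ (by simpa [hker] using hIfg)⟩
    exact IsNoetherian.noetherian _

/-! ### From unital algebras to chains of non-unital subalgebras. -/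

section Chains

variable {k A : Type*} [Field k] [NonUnitalRing A] [Module k A]

lemma finrank_add_le_of_covBy [Module.Finite k A] {t : ℕ}
    {c : Fin (t + 1) → NonUnitalSubalgebra k A} (h : ∀ i : Fin t, c i.succ ⋖ c i.castSucc)
    (i : Fin (t + 1)) : Module.finrank k (c i).toSubmodule + i ≤ Module.finrank k A := by
  induction i using Fin.induction with
  | zero => simpa using Submodule.finrank_le (c 0).toSubmodule
  | succ i ih =>
    have : Module.finrank k (c i.succ).toSubmodule < Module.finrank k (c i.castSucc).toSubmodule :=
      Submodule.finrank_lt_finrank_of_lt (h i).lt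
    simp only [Fin.val_succ, Fin.val_castSucc] at ih ⊢
    omega

variable [IsScalarTower k A A] [SMulCommClass k A A]

/-- The unital subalgebra `k ⊕ M` of the unitization of `A`. -/
def unitizationSubalgebra (M : NonUnitalSubalgebra k A) : Subalgebra k (Unitization k A) where
  carrier := {x | x.snd ∈ M}
  mul_mem' {x y} hx hy := by
    change (x * y).snd ∈ M
    rw [Unitization.snd_mul]
    exact add_mem (add_mem (M.smul_mem x.fst hy) (M.smul_mem y.fst hx)) (M.mul_mem hx hy)
  add_mem' {x y} hx hy := M.add_mem hx hy
  algebraMap_mem' r := M.zero_mem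

/-- A unital subalgebra contains the scalars, so it is `k ⊕ N` with `N` its intersection with `A`.
-/
lemma isCoatom_unitizationSubalgebra {M : NonUnitalSubalgebra k A} (hM : IsCoatom M) :
    IsCoatom (unitizationSubalgebra M) := by
  constructor
  · intro h
    apply hM.1
    rw [eq_top_iff]
    intro x _
    have : (x : Unitization k A) ∈ unitizationSubalgebra M := h ▸ Algebra.mem_top
    exact this
  · intro S hS
    let N : NonUnitalSubalgebra k A :=
      S.toNonUnitalSubalgebra.comap (Unitization.inrNonUnitalAlgHom k A)
    have hsplit : ∀ x : Unitization k A, x ∈ S ↔ x.snd ∈ N := by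
      intro x
      conv_lhs => rw [← Unitization.inl_fst_add_inr_snd_eq x]
      have h1 : (Unitization.inl x.fst : Unitization k A) ∈ S := S.algebraMap_mem x.fst
      exact ⟨fun h => (by simpa using S.sub_mem h h1 : (x.snd : Unitization k A) ∈ S),
        fun h => S.add_mem h1 h⟩
    have hN : N = ⊤ := by
      refine hM.2 N (lt_of_le_of_ne (fun m hm => ?_) ?_)
      · exact hS.le (show ((m : Unitization k A)).snd ∈ M from hm)
      · rintro rfl
        exact hS.ne (Subalgebra.ext fun x => (hsplit x).symm)
    rw [eq_top_iff]
    intro x _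
    rw [hsplit, hN]
    trivial

/-- An algebra with a finite-dimensional maximal subalgebra is finite-dimensional. -/
lemma finite_of_nonUnital_isCoatom {M : NonUnitalSubalgebra k A} (hM : IsCoatom M)
    (hf : M.toSubmodule.FG) : Module.Finite k A := by
  have hMf : (unitizationSubalgebra M).toSubmodule.FG := by
    refine ((Submodule.fg_span_singleton (1 : Unitization k A)).sup
      (hf.map (Unitization.inrHom k k A))).of_le fun x hx => ?_
    rw [← Unitization.inl_fst_add_inr_snd_eq x]
    refine Submodule.add_mem_sup (Submodule.mem_span_singleton.2 ⟨x.fst, ?_⟩) ⟨x.snd, hx, rfl⟩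
    ext <;> simp
  have : Module.Finite k (Unitization k A) :=
    finite_of_isCoatom _ (isCoatom_unitizationSubalgebra hM) (Module.Finite.iff_fg.2 hMf) le_rfl
  exact Module.Finite.of_surjective (Unitization.sndHom k k A) fun x => ⟨x, rfl⟩

/-- `B` is a coatom once `C` is taken as the ambient algebra. -/
lemma fg_of_covBy {B C : NonUnitalSubalgebra k A} (h : B ⋖ C) (hB : B.toSubmodule.FG) :
    C.toSubmodule.FG := by
  let M : NonUnitalSubalgebra k C := B.comap (NonUnitalSubalgebraClass.subtype C)
  have hM : IsCoatom M := by
    constructor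
    · intro hM
      refine h.lt.not_ge fun x hx => ?_
      have : (⟨x, hx⟩ : C) ∈ M := hM ▸ NonUnitalAlgebra.mem_top
      exact this
    · intro N hN
      let N' : NonUnitalSubalgebra k A := N.map (NonUnitalSubalgebraClass.subtype C)
      have hN'C : N' ≤ C := by
        rintro _ ⟨x, _, rfl⟩
        exact x.2
      have hBN' : B < N' := by
        refine lt_of_le_not_ge (fun b hb => ?_) fun hle => ?_
        · exact ⟨⟨b, h.le hb⟩, hN.le hb, rfl⟩
        · exact hN.not_ge fun x hx => hle ⟨x, hx, rfl⟩
      have hN' : N' = C := (hN'C.lt_or_eq).resolve_left fun hlt => h.2 hBN' hlt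
      rw [eq_top_iff]
      intro x _
      obtain ⟨y, hy, hyx⟩ : (x : A) ∈ N' := hN'.ge x.2
      obtain rfl : y = x := Subtype.ext hyx
      exact hy
  have hMfg : M.toSubmodule.FG := by
    refine Submodule.fg_of_fg_map_injective C.toSubmodule.subtype Subtype.val_injective
      (hB.of_le ?_)
    rintro _ ⟨x, hx, rfl⟩
    exact hx
  have : Module.Finite k C := finite_of_nonUnital_isCoatom hM hMfg
  exact Module.Finite.iff_fg.1 this

lemma finite_of_isUnrefinableChain {t : ℕ} {c : Fin (t + 1) → NonUnitalSubalgebra k A}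
    (hc : IsUnrefinableChain k A t c) : Module.Finite k A := by
  have key : ∀ i : Fin (t + 1), (c i).toSubmodule.FG := by
    intro i
    induction i using Fin.reverseInduction with
    | last => rw [hc.2.1, NonUnitalAlgebra.toSubmodule_bot]; exact Submodule.fg_bot
    | cast i ih => exact fg_of_covBy (hc.2.2 i) ih
  have h0 := key 0
  rw [hc.1] at h0
  exact ⟨h0⟩

lemma exists_chain_of_finite [Module.Finite k A] (n : ℕ) : ∀ C : NonUnitalSubalgebra k A,
    Module.finrank k C.toSubmodule = n → ∃ (t : ℕ) (c : Fin (t + 1) → NonUnitalSubalgebra k A),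
      c 0 = C ∧ c (Fin.last t) = ⊥ ∧ ∀ i : Fin t, c i.succ ⋖ c i.castSucc := by
  induction n using Nat.strong_induction_on with
  | _ n ih =>
    intro C hC
    by_cases h0 : C = ⊥
    · exact ⟨0, fun _ => C, rfl, h0, fun i => i.elim0⟩
    have hlt : ∀ {B C : NonUnitalSubalgebra k A}, B < C →
        Module.finrank k B.toSubmodule < Module.finrank k C.toSubmodule := fun h =>
      Submodule.finrank_lt_finrank_of_lt h
    obtain ⟨B, hBC⟩ : ∃ B, B ⋖ C := by
      have hwf : WellFoundedGT (NonUnitalSubalgebra k A) :=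
        ⟨Subrelation.wf (r := InvImage (· > ·) fun B : NonUnitalSubalgebra k A => B.toSubmodule)
          (fun h => h) (InvImage.wf _ wellFounded_gt)⟩
      obtain ⟨B, hB, hmax⟩ := hwf.wf.has_min {B | B < C} ⟨⊥, bot_lt_iff_ne_bot.2 h0⟩
      exact ⟨B, hB, fun D hBD hDC => hmax D hDC hBD⟩
    obtain ⟨t, c, hc0, hct, hc⟩ := ih _ (hC ▸ hlt hBC.lt) B rfl
    refine ⟨t + 1, Fin.cons C c, rfl, ?_, fun i => ?_⟩
    · rw [← Fin.succ_last, Fin.cons_succ, hct]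
    · rw [Fin.cons_succ]
      induction i using Fin.cases with
      | zero => simpa [hc0] using hBC
      | succ i =>
        rw [← Fin.succ_castSucc, Fin.cons_succ]
        exact hc i

lemma exists_isGreatest_chainLengths [Module.Finite k A] :
    ∃ t, IsGreatest (chainLengths k A) t := by
  obtain ⟨t, c, hc⟩ := exists_chain_of_finite _ (⊤ : NonUnitalSubalgebra k A) rfl
  have hne : (chainLengths k A).Nonempty := ⟨t, c, hc⟩
  have hb : BddAbove (chainLengths k A) := by
    refine ⟨Module.finrank k A, ?_⟩
    rintro t ⟨c, hc⟩
    -- Each step of a chain loses at least one dimension, so `t ≤ dim A`.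
    have := finrank_add_le_of_covBy hc.2.2 (Fin.last t)
    rw [Fin.val_last] at this
    omega
  exact ⟨_, Nat.sSup_mem hne hb, fun t ht => le_csSup hb ht⟩

end Chains

end AlgChain

theorem mainTheorem2 {k : Type*} {A : Type*} [Field k] [NonUnitalRing A] [Module k A]
    [IsScalarTower k A A] [SMulCommClass k A A] :
    [AlgChain.depth k A < ⊤, AlgChain.length k A < ⊤, FiniteDimensional k A].TFAE := by
  tfae_have 1 → 3 := by
    intro h
    by_cases hne : (AlgChain.chainLengths k A).Nonempty
    · obtain ⟨t, c, hc⟩ := hne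
      exact AlgChain.finite_of_isUnrefinableChain hc
    · simp [AlgChain.depth, hne] at h
  tfae_have 3 → 2 := by
    intro h
    simp [AlgChain.length, AlgChain.exists_isGreatest_chainLengths]
  tfae_have 2 → 1 := by
    intro h
    by_cases hg : ∃ t, IsGreatest (AlgChain.chainLengths k A) t
    · obtain ⟨t, ht⟩ := hg
      have hne : (AlgChain.chainLengths k A).Nonempty := ⟨t, ht.1⟩
      simp [AlgChain.depth, hne]
    · simp [AlgChain.length, hg] at h
  tfae_finish
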